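/- Let $(\theta_k)_{k\ge 1}$ be independent copies of a real random variable $\theta$, all defined on a common probability space $(\Omega,\mathcal F,\mathbb P)$. Let $a,b\in\mathbb R$, let the sequence $(\xi_k)_{k\ge -1}$ be given by $$\xi_{-1}=\xi_0=0,\qquad \xi_k=a\,\xi_{k-1}+b\,\xi_{k-2}+\theta_k,\quad k\ge 1,$$ and let $S_n=\sum_{k=1}^n\xi_k$, $n\ge 1$. Assume that $-1<b<1-|a|$, $0<p<2$ and $r\ge p$. If $\mathbb E|\theta|^r<\infty$, and in addition $\mathbb E\theta=0$ in the case $r\ge 1$, then for every $\varepsilon>0$ $$\sum_{n=1}^\infty n^{\frac rp-2}\,\mathbb P\Big\{\frac{|S_n|}{n^{1/p}}>\varepsilon\Big\}<\infty .$$ -/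

import Mathlib

open MeasureTheory ProbabilityTheory

/-- `ξ` is the linear second order autoregressive sequence with coefficients `a`, `b`,
zero initial values and innovations `θ`:
`ξ₋₁ = ξ₀ = 0` and `ξ_k = a ξ_{k-1} + b ξ_{k-2} + θ_k` for `k ≥ 1`. -/
def IsAutoregressive2 {Ω : Type*} (a b : ℝ) (θ : ℕ+ → Ω → ℝ) (ξ : ℤ → Ω → ℝ) : Prop :=
  (∀ ω, ξ (-1) ω = 0) ∧ (∀ ω, ξ 0 ω = 0) ∧
    ∀ (k : ℕ+) (ω : Ω),
      ξ ((k : ℕ) : ℤ) ω =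
        a * ξ (((k : ℕ) : ℤ) - 1) ω + b * ξ (((k : ℕ) : ℤ) - 2) ω + θ k ω

/-- The partial sum `S_n = ξ_1 + ⋯ + ξ_n`. -/
def partialSum {Ω : Type*} (ξ : ℤ → Ω → ℝ) (n : ℕ) (ω : Ω) : ℝ :=
  ∑ k ∈ Finset.Icc 1 n, ξ (k : ℤ) ω

/-! Unrolling the recursion writes `S_n` as a weighted sum of the first `n` innovations, the weights
being values of the step response (`partialSum_eq_sum_stepResponse`). Inside the stability triangle
these weights are bounded, so everything reduces to complete convergence for weighted sums of
independent copies with bounded weights (`summable_prob_weighted_sum`).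

There each variable is truncated at `δ n ^ (1 / p)`. The event that some variable is cut costs `n
ℙ(|θ| > δ n ^ (1 / p))`, whose weighted series is controlled by `𝔼|θ| ^ r`. The truncated sum is
handled by Markov's inequality for `r < 1`, Chebyshev's for `1 ≤ r < 2`, and an exponential bound
for `r ≥ 2`. In the first two ranges the truncated moment of order `q = 1` or `2` exceeds `r`, and
its weighted series is again controlled by `𝔼|θ| ^ r`. In the last two, truncation destroys
centring, but the resulting drift is `o(n ^ (1 / p))`. -/

/-! ### Boundedness of the step response. -/

/-- Solutions of a second order linear recursion inside the stability triangle are bounded. -/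
theorem exists_bound_of_stable_recursion {a b : ℝ} (hb₁ : -1 < b) (hb₂ : b < 1 - |a|)
    (x : ℕ → ℝ) (hx : ∀ n, x (n + 2) = a * x (n + 1) + b * x n) :
    ∃ C, ∀ n, |x n| ≤ C := by
  -- A Lyapunov form: its coefficients make the one-step decrease a nonnegative multiple of `x n ^
  -- 2` alone, and completing the square in `x (n + 1)` shows that it dominates `x n ^ 2`.
  set V : ℕ → ℝ := fun n => (1 - b) * x (n + 1) ^ 2 + 2 * a * b * x (n + 1) * x n +
    ((1 - b) - a ^ 2 * (1 + b)) * x n ^ 2 with hV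
  have hab : a ^ 2 < (1 - b) ^ 2 := by
    rw [← sq_abs]
    exact pow_lt_pow_left₀ (by linarith) (abs_nonneg a) two_ne_zero
  have hb : 0 < 1 - b := by linarith [abs_nonneg a]
  have hdec : ∀ n, V (n + 1) ≤ V n := by
    intro n
    have h : V n - V (n + 1) = (1 + b) * ((1 - b) ^ 2 - a ^ 2) * x n ^ 2 := by
      simp only [hV, hx n, add_assoc, Nat.reduceAdd]
      ring
    have : 0 ≤ (1 + b) * ((1 - b) ^ 2 - a ^ 2) * x n ^ 2 :=
      mul_nonneg (mul_nonneg (by linarith) (by linarith)) (sq_nonneg _)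
    linarith
  have hV0 : ∀ n, V n ≤ V 0 := fun n => antitone_nat_of_succ_le hdec (Nat.zero_le n)
  have hlow : ∀ n, ((1 - b) ^ 2 - a ^ 2) * x n ^ 2 ≤ (1 - b) * V n := by
    intro n
    have h : (1 - b) * V n - ((1 - b) ^ 2 - a ^ 2) * x n ^ 2 =
        ((1 - b) * x (n + 1) + a * b * x n) ^ 2 := by
      simp only [hV]
      ring
    nlinarith [sq_nonneg ((1 - b) * x (n + 1) + a * b * x n)]
  refine ⟨√((1 - b) * V 0 / ((1 - b) ^ 2 - a ^ 2)), fun n => Real.abs_le_sqrt ?_⟩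
  rw [le_div_iff₀ (by linarith)]
  have := mul_le_mul_of_nonneg_left (hV0 n) hb.le
  linarith [hlow n]

/-- The response of the partial sums of an autoregressive sequence to a unit innovation. -/
def stepResponse (a b : ℝ) : ℕ → ℝ
  | 0 => 1
  | 1 => a + 1
  | n + 2 => a * stepResponse a b (n + 1) + b * stepResponse a b n + 1

theorem exists_bound_stepResponse {a b : ℝ} (hb₁ : -1 < b) (hb₂ : b < 1 - |a|) :
    ∃ C, 0 < C ∧ ∀ n, |stepResponse a b n| ≤ C := by
  have hab : 1 - a - b ≠ 0 := by linarith [le_abs_self a]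
  -- Subtracting the fixed point `1 / (1 - a - b)` makes the recursion homogeneous.
  obtain ⟨C, hC⟩ := exists_bound_of_stable_recursion hb₁ hb₂
    (fun n => stepResponse a b n - 1 / (1 - a - b)) (fun n => by
      simp only [stepResponse]
      field_simp
      ring)
  refine ⟨C + |1 / (1 - a - b)| + 1, ?_, fun n => ?_⟩
  · have := (abs_nonneg _).trans (hC 0)
    positivity
  · have h := abs_add_le (stepResponse a b n - 1 / (1 - a - b)) (1 / (1 - a - b))
    rw [sub_add_cancel] at h
    linarith [hC n]

/-- Summing the recursion, with zero initial values, shows that the partial sums obey it too, driven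
by the cumulative innovations. Each innovation thus acts as a constant unit forcing from its own
time on. -/
theorem partialSum_eq_sum_stepResponse {Ω : Type*} {a b : ℝ} {θ : ℕ+ → Ω → ℝ} {ξ : ℤ → Ω → ℝ}
    (hξ : IsAutoregressive2 a b θ ξ) (n : ℕ) (ω : Ω) :
    partialSum ξ n ω =
      ∑ k ∈ Finset.range n, stepResponse a b (n - 1 - k) * θ k.succPNat ω := by
  obtain ⟨h1, h0, hrec⟩ := hξ
  have hsucc : ∀ n, partialSum ξ (n + 1) ω = partialSum ξ n ω + ξ ((n : ℤ) + 1) ω := by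
    intro n
    simp only [partialSum]
    rw [Finset.sum_Icc_succ_top (by omega)]
    push_cast
    rfl
  have hzero : partialSum ξ 0 ω = 0 := by simp [partialSum]
  have hone : ξ 1 ω = θ (Nat.succPNat 0) ω := by
    have := hrec (Nat.succPNat 0) ω
    simpa [h0, h1] using this
  have hstep : ∀ n : ℕ, ξ ((n : ℤ) + 2) ω =
      a * ξ ((n : ℤ) + 1) ω + b * ξ (n : ℤ) ω + θ (Nat.succPNat (n + 1)) ω := by
    intro n
    have := hrec (Nat.succPNat (n + 1)) ω
    rw [Nat.succPNat_coe] at this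
    push_cast at this
    rwa [show (n : ℤ) + 1 + 1 - 1 = n + 1 by ring, show (n : ℤ) + 1 + 1 - 2 = n by ring,
      show (n : ℤ) + 1 + 1 = n + 2 by ring] at this
  have hsum : ∀ n : ℕ, partialSum ξ (n + 2) ω = a * partialSum ξ (n + 1) ω +
      b * partialSum ξ n ω + ∑ k ∈ Finset.range (n + 2), θ k.succPNat ω := by
    intro n
    induction n with
    | zero =>
      have := hstep 0
      simp only [hsucc, hzero, Finset.sum_range_succ, Finset.sum_range_zero] at *
      norm_num at *
      rw [this, h0, hone]
      ring
    | succ n ih =>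
      have h₂ := hsucc (n + 2)
      have h₁ := hsucc (n + 1)
      have h₃ := hstep (n + 1)
      push_cast at h₁ h₂ h₃
      rw [show (n : ℤ) + 1 + 2 = n + 2 + 1 by ring] at h₃
      rw [Finset.sum_range_succ _ (n + 2)]
      rw [show (n : ℤ) + 1 + 1 = n + 2 by ring] at h₁ h₃
      linear_combination h₂ + h₃ + ih - a * h₁ - b * hsucc n
  induction n using Nat.twoStepInduction with
  | zero => simp [hzero]
  | one => simp [hsucc, hzero, hone, stepResponse]
  | more n ih₀ ih₁ =>
    rw [hsum, ih₀, ih₁, Finset.sum_range_succ _ (n + 1), Finset.sum_range_succ _ (n + 1),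
      Finset.sum_range_succ _ n, Finset.sum_range_succ _ n, Finset.sum_range_succ _ n]
    have : ∀ k ∈ Finset.range n, stepResponse a b (n + 2 - 1 - k) * θ k.succPNat ω =
        a * (stepResponse a b (n + 1 - 1 - k) * θ k.succPNat ω) +
        b * (stepResponse a b (n - 1 - k) * θ k.succPNat ω) + θ k.succPNat ω := by
      intro k hk
      -- This removes the truncated subtractions; the terms `k = n` and `k = n + 1` were split off
      -- and match the two initial values.
      obtain ⟨m, rfl⟩ : ∃ m, n = k + 1 + m := Nat.exists_eq_add_of_le (Finset.mem_range.1 hk)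
      rw [show k + 1 + m + 2 - 1 - k = m + 2 by omega, show k + 1 + m + 1 - 1 - k = m + 1 by omega,
        show k + 1 + m - 1 - k = m by omega, stepResponse]
      ring
    rw [Finset.sum_congr rfl this]
    simp only [Finset.sum_add_distrib, ← Finset.mul_sum]
    simp [stepResponse]
    ring

/-! ### Deterministic power sums for truncated moments and tails. -/

/-- A telescoping majorant that replaces comparison with an integral. It rests on `log u ≥ 1 - 1 /
u` at `u = (n + 1) / n`; the factor `2 ^ (β + 1)` pays for `n + 1 ≤ 2 n`. -/
theorem rpow_neg_sub_one_le_mul_sub {β : ℝ} (hβ : 0 < β) {n : ℕ} (hn : n ≠ 0) :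
    (n : ℝ) ^ (-β - 1) ≤
      2 ^ (β + 1) / β * ((n : ℝ) ^ (-β) - ((n + 1 : ℕ) : ℝ) ^ (-β)) := by
  have hn0 : (0 : ℝ) < n := by exact_mod_cast Nat.pos_of_ne_zero hn
  have hn1 : (1 : ℝ) ≤ n := by exact_mod_cast Nat.one_le_iff_ne_zero.2 hn
  push_cast
  have h1 : β * ((n : ℝ) + 1) ^ (-β - 1) ≤ (n : ℝ) ^ (-β) - ((n : ℝ) + 1) ^ (-β) := by
    have hratio : 1 + β / ((n : ℝ) + 1) ≤ (((n : ℝ) + 1) / n) ^ β := by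
      rw [Real.rpow_def_of_pos (by positivity)]
      have hlog : 1 / ((n : ℝ) + 1) ≤ Real.log (((n : ℝ) + 1) / n) := by
        have := Real.one_sub_inv_le_log_of_pos (x := ((n : ℝ) + 1) / n) (by positivity)
        refine le_trans (le_of_eq ?_) this
        field_simp
        ring
      have := Real.add_one_le_exp (Real.log (((n : ℝ) + 1) / n) * β)
      have h2 := mul_le_mul_of_nonneg_right hlog hβ.le
      have h3 : 1 / ((n : ℝ) + 1) * β = β / ((n : ℝ) + 1) := by ring
      linarith
    have hpos : (0 : ℝ) < ((n : ℝ) + 1) ^ (-β) := by positivity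
    have h4 := mul_le_mul_of_nonneg_left hratio hpos.le
    have h5 : ((n : ℝ) + 1) ^ (-β) * (((n : ℝ) + 1) / n) ^ β = (n : ℝ) ^ (-β) := by
      rw [Real.div_rpow (by positivity) hn0.le, Real.rpow_neg (by positivity),
        Real.rpow_neg hn0.le]
      field_simp
    have h6 : ((n : ℝ) + 1) ^ (-β - 1) = ((n : ℝ) + 1) ^ (-β) / ((n : ℝ) + 1) :=
      Real.rpow_sub_one (by positivity) _
    rw [h5] at h4
    rw [h6]
    have h7 : ((n : ℝ) + 1) ^ (-β) * (1 + β / ((n : ℝ) + 1)) =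
      ((n : ℝ) + 1) ^ (-β) + β * (((n : ℝ) + 1) ^ (-β) / ((n : ℝ) + 1)) := by ring
    linarith
  have h2 : (n : ℝ) ^ (-β - 1) ≤ 2 ^ (β + 1) * ((n : ℝ) + 1) ^ (-β - 1) := by
    have h3 : (2 * (n : ℝ)) ^ (-β - 1) ≤ ((n : ℝ) + 1) ^ (-β - 1) :=
      Real.rpow_le_rpow_of_nonpos (by positivity) (by linarith) (by linarith)
    rw [Real.mul_rpow (by norm_num) hn0.le] at h3
    have h4 := mul_le_mul_of_nonneg_left h3 (by positivity : (0 : ℝ) ≤ 2 ^ (β + 1))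
    rw [← mul_assoc, ← Real.rpow_add (by norm_num)] at h4
    simpa using h4
  calc (n : ℝ) ^ (-β - 1) ≤ 2 ^ (β + 1) * ((n : ℝ) + 1) ^ (-β - 1) := h2
    _ = 2 ^ (β + 1) / β * (β * ((n : ℝ) + 1) ^ (-β - 1)) := by field_simp
    _ ≤ _ := by gcongr

theorem sum_Ico_rpow_neg_sub_one_le {β : ℝ} (hβ : 0 < β) {m N : ℕ} (hm : m ≠ 0) :
    ∑ n ∈ Finset.Ico m N, (n : ℝ) ^ (-β - 1) ≤ 2 ^ (β + 1) / β * (m : ℝ) ^ (-β) := by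
  rcases lt_or_ge N m with h | h
  · rw [Finset.Ico_eq_empty_of_le h.le]
    simp only [Finset.sum_empty]
    positivity
  calc ∑ n ∈ Finset.Ico m N, (n : ℝ) ^ (-β - 1)
      ≤ ∑ n ∈ Finset.Ico m N,
          2 ^ (β + 1) / β * ((n : ℝ) ^ (-β) - ((n + 1 : ℕ) : ℝ) ^ (-β)) :=
        Finset.sum_le_sum fun n hn => rpow_neg_sub_one_le_mul_sub hβ
          (by have := Finset.mem_Ico.1 hn; omega)
    _ = 2 ^ (β + 1) / β * ((m : ℝ) ^ (-β) - (N : ℝ) ^ (-β)) := by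
        rw [← Finset.mul_sum]
        congr 1
        have := Finset.sum_Ico_sub (fun n : ℕ => -(n : ℝ) ^ (-β)) h
        rw [neg_sub_neg] at this
        rw [← this]
        exact Finset.sum_congr rfl fun _ _ => by ring
    _ ≤ _ := by
        gcongr
        have : (0 : ℝ) ≤ (N : ℝ) ^ (-β) := by positivity
        linarith

/-- The number `x` if `|x| ≤ M`, and `0` otherwise. -/
noncomputable def clip (M x : ℝ) : ℝ := Set.indicator {y : ℝ | |y| ≤ M} id x

theorem clip_of_le {M x : ℝ} (h : |x| ≤ M) : clip M x = x := Set.indicator_of_mem (s := {y : ℝ | |y| ≤ M}) h _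

theorem clip_of_lt {M x : ℝ} (h : M < |x|) : clip M x = 0 :=
  Set.indicator_of_notMem (by simpa using h) _

theorem measurable_clip (M : ℝ) : Measurable (clip M) :=
  measurable_id.indicator (measurableSet_le measurable_abs measurable_const)

theorem abs_clip_le_abs (M x : ℝ) : |clip M x| ≤ |x| := by
  rcases le_or_gt |x| M with h | h
  · rw [clip_of_le h]
  · simp [clip_of_lt h]

theorem abs_clip_le {M : ℝ} (hM : 0 ≤ M) (x : ℝ) : |clip M x| ≤ M := by
  rcases le_or_gt |x| M with h | h
  · rwa [clip_of_le h]
  · simpa [clip_of_lt h] using hM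

/-- Summation of the truncated moments of order `q > r` against the weights that balance a moment
of order `r`: pointwise form. -/
theorem sum_rpow_mul_abs_clip_rpow_le {p r q : ℝ} (hp : 0 < p) (hq : 0 < q) (hrq : r < q)
    (x : ℝ) (N : ℕ) :
    ∑ n ∈ Finset.range N, (n : ℝ) ^ ((r - q) / p - 1) * |clip ((n : ℝ) ^ (1 / p)) x| ^ q ≤
      2 ^ ((q - r) / p + 1) / ((q - r) / p) * |x| ^ r := by
  set β := (q - r) / p with hβ
  have hβ0 : 0 < β := div_pos (by linarith) hp
  have hexp : (r - q) / p - 1 = -β - 1 := by rw [hβ]; ring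
  rw [hexp]
  rcases eq_or_ne x 0 with rfl | hx
  · have : ∀ n : ℕ, clip ((n : ℝ) ^ (1 / p)) 0 = 0 := fun n => by
      have := abs_clip_le_abs ((n : ℝ) ^ (1 / p)) 0
      simpa using this
    simp only [this, abs_zero, Real.zero_rpow hq.ne', mul_zero, Finset.sum_const_zero]
    positivity
  have hx0 : 0 < |x| := abs_pos.2 hx
  -- The truncation of `x` vanishes for `n < m`, so only the tail of the power series from `m` on
  -- contributes.
  set m := ⌈|x| ^ p⌉₊ with hm
  have hm0 : m ≠ 0 := (Nat.ceil_pos.2 (by positivity)).ne'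
  have hterm : ∀ n ∈ Finset.range N,
      (n : ℝ) ^ (-β - 1) * |clip ((n : ℝ) ^ (1 / p)) x| ^ q ≤
        if m ≤ n then (n : ℝ) ^ (-β - 1) * |x| ^ q else 0 := by
    intro n _
    split_ifs with h
    · exact mul_le_mul_of_nonneg_left
        (Real.rpow_le_rpow (abs_nonneg _) (abs_clip_le_abs _ _) hq.le) (by positivity)
    · rw [clip_of_lt, abs_zero, Real.zero_rpow hq.ne', mul_zero]
      rw [not_le, hm, Nat.lt_ceil] at h
      rw [one_div]
      exact (Real.rpow_inv_lt_iff_of_pos (by positivity) hx0.le hp).2 h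
  calc _ ≤ ∑ n ∈ Finset.range N, if m ≤ n then (n : ℝ) ^ (-β - 1) * |x| ^ q else 0 :=
        Finset.sum_le_sum hterm
    _ = (∑ n ∈ Finset.Ico m N, (n : ℝ) ^ (-β - 1)) * |x| ^ q := by
        rw [← Finset.sum_filter, Finset.sum_mul]
        refine Finset.sum_congr ?_ fun _ _ => rfl
        ext n
        simp [and_comm]
    _ ≤ (2 ^ (β + 1) / β * (m : ℝ) ^ (-β)) * |x| ^ q := by
        gcongr
        exact sum_Ico_rpow_neg_sub_one_le hβ0 hm0
    _ ≤ (2 ^ (β + 1) / β * (|x| ^ p) ^ (-β)) * |x| ^ q := by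
        have := Real.rpow_le_rpow_of_nonpos (z := -β) (by positivity : 0 < |x| ^ p)
          (Nat.le_ceil _) (by linarith)
        gcongr
    _ = 2 ^ (β + 1) / β * |x| ^ r := by
        rw [← Real.rpow_mul hx0.le, mul_assoc, ← Real.rpow_add hx0, hβ]
        congr 2
        field_simp
        ring

/-- Summation of tails against the weights that balance a moment of order `r`: pointwise form. -/
theorem sum_rpow_mul_indicator_le {p r δ : ℝ} (hp : 0 < p) (hr : p ≤ r) (hδ : 0 < δ)
    (x : ℝ) (N : ℕ) :
    ∑ n ∈ Finset.range N, (n : ℝ) ^ (r / p - 1) *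
        Set.indicator {y : ℝ | δ * (n : ℝ) ^ (1 / p) < |y|} (fun _ => (1 : ℝ)) x ≤
      2 * (|x| / δ) ^ r + 1 := by
  set y := (|x| / δ) ^ p with hy
  have hy0 : 0 ≤ y := by positivity
  have hα : 0 ≤ r / p - 1 := by rw [sub_nonneg, one_le_div hp]; exact hr
  -- Only `n < y` contributes: at most `y + 1` terms, each at most `y ^ (r / p - 1)` because `r ≥
  -- p`. The additive 1 in the bound covers `y < 1`.
  set m := ⌈y⌉₊ with hm
  have hterm : ∀ n ∈ Finset.range N, (n : ℝ) ^ (r / p - 1) *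
        Set.indicator {y : ℝ | δ * (n : ℝ) ^ (1 / p) < |y|} (fun _ => (1 : ℝ)) x ≤
      if n < m then y ^ (r / p - 1) else 0 := by
    intro n _
    by_cases hx : δ * (n : ℝ) ^ (1 / p) < |x|
    · rw [Set.indicator_of_mem (by exact hx), mul_one]
      have hny : (n : ℝ) < y := by
        rw [hy]
        refine (Real.rpow_inv_lt_iff_of_pos (by positivity) (by positivity) hp).1 ?_
        rw [lt_div_iff₀ hδ, ← one_div]
        linarith
      rw [if_pos (Nat.lt_ceil.2 hny)]
      gcongr
    · rw [Set.indicator_of_notMem (by exact hx), mul_zero]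
      positivity
  have hyr : (|x| / δ) ^ r = y ^ (r / p) := by
    rw [hy, ← Real.rpow_mul (by positivity)]
    congr 1
    field_simp
  rw [hyr]
  calc _ ≤ ∑ n ∈ Finset.range N, if n < m then y ^ (r / p - 1) else 0 :=
        Finset.sum_le_sum hterm
    _ ≤ ∑ n ∈ Finset.range m, y ^ (r / p - 1) := by
        rw [← Finset.sum_filter]
        refine Finset.sum_le_sum_of_subset_of_nonneg (fun n hn => ?_) fun _ _ _ => by positivity
        exact Finset.mem_range.2 (Finset.mem_filter.1 hn).2
    _ = m * y ^ (r / p - 1) := by simp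
    _ ≤ 2 * y ^ (r / p) + 1 := by
        rcases eq_or_lt_of_le hy0 with h0 | h0
        · rw [hm, ← h0]
          simp only [Nat.ceil_zero, Nat.cast_zero, zero_mul]
          positivity
        have hm1 : (m : ℝ) ≤ y + 1 := (Nat.ceil_lt_add_one hy0).le
        have hmul : y * y ^ (r / p - 1) = y ^ (r / p) := by
          rw [Real.rpow_sub_one h0.ne']
          field_simp
        have hle : y ^ (r / p - 1) ≤ y ^ (r / p) + 1 := by
          rcases le_total y 1 with h | h
          · have := Real.rpow_le_one hy0 h hα
            have h2 : 0 ≤ y ^ (r / p) := by positivity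
            linarith
          · have := Real.rpow_le_rpow_of_exponent_le h (by linarith : r / p - 1 ≤ r / p)
            linarith
        calc (m : ℝ) * y ^ (r / p - 1) ≤ (y + 1) * y ^ (r / p - 1) := by gcongr
          _ ≤ _ := by linarith

theorem summable_integral_of_sum_range_le {Ω : Type*} [MeasurableSpace Ω] {P : Measure Ω}
    {f : ℕ → Ω → ℝ} {g : Ω → ℝ} (hf0 : ∀ n ω, 0 ≤ f n ω) (hf : ∀ n, Integrable (f n) P)
    (hg : Integrable g P) (hfg : ∀ N ω, ∑ n ∈ Finset.range N, f n ω ≤ g ω) :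
    Summable fun n => ∫ ω, f n ω ∂P := by
  refine summable_of_sum_range_le (c := ∫ ω, g ω ∂P) (fun n => integral_nonneg (hf0 n))
    fun N => ?_
  rw [← integral_finsetSum _ fun n _ => hf n]
  exact integral_mono (integrable_finsetSum _ fun n _ => hf n) hg (hfg N)

/-! ### Moments and tails of one truncated variable. -/

section Moments

variable {Ω : Type*} [MeasurableSpace Ω] {P : Measure Ω} [IsProbabilityMeasure P] {θ : Ω → ℝ}

theorem integrable_comp_clip (hθ : AEMeasurable θ P) {M : ℝ} (hM : 0 ≤ M) {g : ℝ → ℝ}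
    (hg : Continuous g) : Integrable (fun ω => g (clip M (θ ω))) P := by
  obtain ⟨C, hC⟩ := (isCompact_Icc (a := -M) (b := M)).exists_bound_of_continuousOn hg.continuousOn
  refine Integrable.of_bound (C := C)
    ((hg.measurable.comp (measurable_clip M)).comp_aemeasurable hθ).aestronglyMeasurable
    (Filter.Eventually.of_forall fun ω => hC _ (abs_le.1 (abs_clip_le hM _)))

theorem summable_integral_abs_clip_rpow (hθ : AEMeasurable θ P) {p r q : ℝ} (hp : 0 < p)
    (hq : 0 < q) (hrq : r < q) (hmoment : Integrable (fun ω => |θ ω| ^ r) P) :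
    Summable fun n : ℕ => (n : ℝ) ^ ((r - q) / p - 1) *
      ∫ ω, |clip ((n : ℝ) ^ (1 / p)) (θ ω)| ^ q ∂P := by
  simp_rw [← integral_const_mul]
  refine summable_integral_of_sum_range_le (fun n ω => by positivity) (fun n => ?_)
    (hmoment.const_mul (2 ^ ((q - r) / p + 1) / ((q - r) / p)))
    fun N ω => sum_rpow_mul_abs_clip_rpow_le hp hq hrq (θ ω) N
  exact (integrable_comp_clip hθ (by positivity) (g := fun x => |x| ^ q)
    (continuous_abs.rpow_const fun _ => Or.inr hq.le)).const_mul _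

theorem summable_rpow_mul_prob_lt_abs (hθ : AEMeasurable θ P) {p r δ : ℝ} (hp : 0 < p)
    (hr : p ≤ r) (hδ : 0 < δ) (hmoment : Integrable (fun ω => |θ ω| ^ r) P) :
    Summable fun n : ℕ => (n : ℝ) ^ (r / p - 1) *
      P.real {ω | δ * (n : ℝ) ^ (1 / p) < |θ ω|} := by
  have hset : ∀ n : ℕ, NullMeasurableSet {ω | δ * (n : ℝ) ^ (1 / p) < |θ ω|} P := fun n =>
    nullMeasurableSet_lt aemeasurable_const hθ.abs
  have hind : ∀ n : ℕ, P.real {ω | δ * (n : ℝ) ^ (1 / p) < |θ ω|} =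
      ∫ ω, Set.indicator {y : ℝ | δ * (n : ℝ) ^ (1 / p) < |y|} (fun _ => (1 : ℝ)) (θ ω) ∂P := by
    intro n
    change _ = ∫ ω, Set.indicator {ω | δ * (n : ℝ) ^ (1 / p) < |θ ω|} (fun _ => (1 : ℝ)) ω ∂P
    rw [integral_indicator₀ (hset n)]
    simp
  simp_rw [hind, ← integral_const_mul]
  refine summable_integral_of_sum_range_le (fun n ω => ?_) (fun n => ?_)
    (((hmoment.div_const (δ ^ r)).const_mul 2).add (integrable_const 1))
    fun N ω => (sum_rpow_mul_indicator_le hp hr hδ (θ ω) N).trans (le_of_eq ?_)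
  · exact mul_nonneg (by positivity) (Set.indicator_nonneg (fun _ _ => zero_le_one) _)
  · refine Integrable.const_mul ?_ _
    exact (integrable_const (1 : ℝ)).indicator₀ (hset n)
  · simp [Real.div_rpow (abs_nonneg _) hδ.le]

theorem integrable_of_integrable_abs_rpow (hθ : AEMeasurable θ P) {r : ℝ} (hr : 1 ≤ r)
    (hmoment : Integrable (fun ω => |θ ω| ^ r) P) : Integrable θ P := by
  refine (hmoment.add (integrable_const 1)).mono' hθ.aestronglyMeasurable
    (Filter.Eventually.of_forall fun ω => ?_)
  simp only [Pi.add_apply, Real.norm_eq_abs]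
  rcases le_total |θ ω| 1 with h | h
  · have : 0 ≤ |θ ω| ^ r := by positivity
    linarith
  · have := Real.rpow_le_rpow_of_exponent_le h hr
    rw [Real.rpow_one] at this
    linarith

/-- The mean of a truncated centred variable is controlled by the tail of a higher moment. -/
theorem abs_integral_clip_le (hθ : AEMeasurable θ P) {r M : ℝ} (hr : 1 ≤ r) (hM : 0 < M)
    (hmoment : Integrable (fun ω => |θ ω| ^ r) P) (hmean : ∫ ω, θ ω ∂P = 0) :
    |∫ ω, clip M (θ ω) ∂P| ≤
      M ^ (1 - r) * ∫ ω, Set.indicator {y : ℝ | M < |y|} (fun y => |y| ^ r) (θ ω) ∂P := by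
  have hint := integrable_of_integrable_abs_rpow hθ hr hmoment
  have hclip : Integrable (fun ω => clip M (θ ω)) P := integrable_comp_clip hθ hM.le continuous_id
  -- By centring only the discarded part `|θ| > M` matters, and there `|θ| ≤ M ^ (1 - r) |θ| ^ r`.
  have h1 : ∫ ω, clip M (θ ω) ∂P = ∫ ω, (clip M (θ ω) - θ ω) ∂P := by
    rw [integral_sub hclip hint, hmean, sub_zero]
  have hset : NullMeasurableSet {ω | M < |θ ω|} P :=
    nullMeasurableSet_lt aemeasurable_const hθ.abs
  rw [h1, ← integral_const_mul, ← Real.norm_eq_abs]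
  refine norm_integral_le_of_norm_le ((hmoment.indicator₀ hset).const_mul _)
    (Filter.Eventually.of_forall fun ω => ?_)
  rw [Real.norm_eq_abs]
  rcases le_or_gt |θ ω| M with h | h
  · rw [clip_of_le h, sub_self, abs_zero]
    exact mul_nonneg (by positivity) (Set.indicator_nonneg (fun _ _ => by positivity) _)
  · have hθ0 : 0 < |θ ω| := hM.trans h
    rw [clip_of_lt h, Set.indicator_of_mem (by exact h), zero_sub, abs_neg]
    have h2 : |θ ω| ^ (1 - r) ≤ M ^ (1 - r) :=
      Real.rpow_le_rpow_of_nonpos hM h.le (by linarith)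
    calc |θ ω| = |θ ω| ^ (1 - r) * |θ ω| ^ r := by
          rw [← Real.rpow_add hθ0]
          simp
      _ ≤ _ := by gcongr

end Moments

theorem tendsto_integral_indicator_abs_rpow {Ω : Type*} [MeasurableSpace Ω] {P : Measure Ω}
    {θ : Ω → ℝ} (hθ : AEMeasurable θ P) {r : ℝ}
    (hmoment : Integrable (fun ω => |θ ω| ^ r) P) {M : ℕ → ℝ}
    (hM : Filter.Tendsto M Filter.atTop Filter.atTop) :
    Filter.Tendsto
      (fun n => ∫ ω, Set.indicator {y : ℝ | M n < |y|} (fun y => |y| ^ r) (θ ω) ∂P)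
      Filter.atTop (nhds 0) := by
  rw [← integral_zero Ω ℝ (μ := P)]
  refine tendsto_integral_of_dominated_convergence (fun ω => |θ ω| ^ r) (fun n => ?_) hmoment
    (fun n => Filter.Eventually.of_forall fun ω => ?_) (Filter.Eventually.of_forall fun ω => ?_)
  · exact (hmoment.indicator₀
      (nullMeasurableSet_lt aemeasurable_const hθ.abs : NullMeasurableSet {ω | M n < |θ ω|} P)).1
  · refine (norm_indicator_le_norm_self _ _).trans (le_of_eq ?_)
    rw [Real.norm_eq_abs, abs_of_nonneg (by positivity)]
  · refine tendsto_const_nhds.congr' ?_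
    filter_upwards [hM.eventually_ge_atTop |θ ω|] with n hn
    exact (Set.indicator_of_notMem (by simpa using hn) _).symm

/-! ### Tail probabilities of weighted sums. -/

theorem exp_le_one_add_self_add_sq_mul (x : ℝ) :
    Real.exp x ≤ 1 + x + x ^ 2 * Real.exp |x| := by
  have h := Complex.norm_exp_sub_sum_le_norm_mul_exp (x : ℂ) 2
  have h2 : Complex.exp x - ∑ m ∈ Finset.range 2, (x : ℂ) ^ m / (m.factorial : ℂ) =
      ((Real.exp x - (1 + x) : ℝ) : ℂ) := by
    simp [Finset.sum_range_succ]
  rw [h2, Complex.norm_real, Complex.norm_real, Real.norm_eq_abs, Real.norm_eq_abs, sq_abs] at h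
  linarith [le_abs_self (Real.exp x - (1 + x))]

theorem integral_comp_clip_eq {Ω : Type*} [MeasurableSpace Ω] {P : Measure Ω}
    {θ : Ω → ℝ} {X : ℕ → Ω → ℝ} (hcopy : ∀ k, IdentDistrib (X k) θ P P) (M : ℝ)
    {g : ℝ → ℝ} (hg : Measurable g) (k : ℕ) :
    ∫ ω, g (clip M (X k ω)) ∂P = ∫ ω, g (clip M (θ ω)) ∂P :=
  ((hcopy k).comp (hg.comp (measurable_clip M))).integral_eq

theorem iIndepFun_mul_clip {Ω : Type*} [MeasurableSpace Ω] {P : Measure Ω}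
    {X : ℕ → Ω → ℝ} (hindep : iIndepFun X P) (w : ℕ → ℝ) (M : ℝ) :
    iIndepFun (fun k ω => w k * clip M (X k ω)) P :=
  hindep.comp (fun k x => w k * clip M x) fun _ => (measurable_clip M).const_mul _

section WeightedSums

variable {Ω : Type*} [MeasurableSpace Ω] {P : Measure Ω} [IsProbabilityMeasure P] {θ : Ω → ℝ}
  {X : ℕ → Ω → ℝ}

/-- Unless one of the `n` variables exceeds `M`, truncation changes nothing; a union bound does the
rest. -/
theorem prob_lt_abs_sum_le_add (hcopy : ∀ k, IdentDistrib (X k) θ P P) (w : ℕ → ℝ) (n : ℕ)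
    (M t : ℝ) :
    P.real {ω | t < |∑ k ∈ Finset.range n, w k * X k ω|} ≤
      n * P.real {ω | M < |θ ω|} +
        P.real {ω | t < |∑ k ∈ Finset.range n, w k * clip M (X k ω)|} := by
  have hsub : {ω | t < |∑ k ∈ Finset.range n, w k * X k ω|} ⊆
      (⋃ k ∈ Finset.range n, {ω | M < |X k ω|}) ∪
        {ω | t < |∑ k ∈ Finset.range n, w k * clip M (X k ω)|} := by
    intro ω hω
    by_cases h : ∀ k ∈ Finset.range n, |X k ω| ≤ M
    · right
      have : ∑ k ∈ Finset.range n, w k * clip M (X k ω) = ∑ k ∈ Finset.range n, w k * X k ω :=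
        Finset.sum_congr rfl fun k hk => by rw [clip_of_le (h k hk)]
      simpa only [Set.mem_ofPred_eq, this] using hω
    · left
      push Not at h
      simpa using h
  have heq : ∀ k, P.real {ω | M < |X k ω|} = P.real {ω | M < |θ ω|} := by
    intro k
    have := (hcopy k).measure_mem_eq (s := {y : ℝ | M < |y|})
      (measurableSet_lt measurable_const measurable_abs)
    exact congrArg ENNReal.toReal this
  calc _ ≤ _ := measureReal_mono hsub
    _ ≤ _ := measureReal_union_le _ _
    _ ≤ _ := by
      gcongr
      refine (measureReal_biUnion_finset_le _ _).trans (le_of_eq ?_)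
      simp [heq]

theorem prob_lt_abs_sum_clip_le_integral_abs (hcopy : ∀ k, IdentDistrib (X k) θ P P) {w : ℕ → ℝ}
    (hw : ∀ k, |w k| ≤ 1) (n : ℕ) {M t : ℝ} (hM : 0 ≤ M) (ht : 0 < t) :
    P.real {ω | t < |∑ k ∈ Finset.range n, w k * clip M (X k ω)|} ≤
      n * (∫ ω, |clip M (θ ω)| ∂P) / t := by
  have hint : ∀ k, Integrable (fun ω => |clip M (X k ω)|) P := fun k =>
    integrable_comp_clip (hcopy k).aemeasurable_fst hM continuous_abs
  have hsum : Integrable (fun ω => ∑ k ∈ Finset.range n, |clip M (X k ω)|) P :=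
    integrable_finsetSum _ fun k _ => hint k
  have hmarkov := mul_meas_ge_le_integral_of_nonneg
    (Filter.Eventually.of_forall fun ω => Finset.sum_nonneg fun k _ => abs_nonneg _) hsum t
  rw [integral_finsetSum _ fun k _ => hint k] at hmarkov
  simp only [integral_comp_clip_eq hcopy M measurable_abs, Finset.sum_const,
    Finset.card_range, nsmul_eq_mul] at hmarkov
  rw [le_div_iff₀ ht, mul_comm]
  refine le_trans ?_ hmarkov
  refine mul_le_mul_of_nonneg_left (measureReal_mono fun ω hω => ?_) ht.le
  have hω' : t < |∑ k ∈ Finset.range n, w k * clip M (X k ω)| := hω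
  refine hω'.le.trans ((Finset.abs_sum_le_sum_abs _ _).trans (Finset.sum_le_sum fun k _ => ?_))
  rw [abs_mul]
  exact mul_le_of_le_one_left (abs_nonneg _) (hw k)

theorem abs_integral_sum_clip_le (hcopy : ∀ k, IdentDistrib (X k) θ P P) {w : ℕ → ℝ}
    (hw : ∀ k, |w k| ≤ 1) (n : ℕ) {M : ℝ} (hM : 0 ≤ M) :
    |∫ ω, ∑ k ∈ Finset.range n, w k * clip M (X k ω) ∂P| ≤ n * |∫ ω, clip M (θ ω) ∂P| := by
  have hint : ∀ k, Integrable (fun ω => w k * clip M (X k ω)) P := fun k =>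
    (integrable_comp_clip (hcopy k).aemeasurable_fst hM continuous_id).const_mul _
  rw [integral_finsetSum _ fun k _ => hint k]
  refine (Finset.abs_sum_le_sum_abs _ _).trans ?_
  have : ∀ k ∈ Finset.range n,
      |∫ ω, w k * clip M (X k ω) ∂P| ≤ |∫ ω, clip M (θ ω) ∂P| := fun k _ => by
    rw [integral_const_mul, abs_mul,
      integral_comp_clip_eq hcopy M (g := fun x => x) measurable_id]
    exact mul_le_of_le_one_left (abs_nonneg _) (hw k)
  refine (Finset.sum_le_sum this).trans (le_of_eq ?_)
  simp

/-- Chebyshev's inequality at level `t / 2`, the other half of `t` absorbing the mean left by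
truncation. -/
theorem prob_lt_abs_sum_clip_le_integral_sq (hindep : iIndepFun X P)
    (hcopy : ∀ k, IdentDistrib (X k) θ P P) {w : ℕ → ℝ}
    (hw : ∀ k, |w k| ≤ 1) (n : ℕ) {M t : ℝ} (hM : 0 ≤ M) (ht : 0 < t)
    (hmean : n * |∫ ω, clip M (θ ω) ∂P| ≤ t / 2) :
    P.real {ω | t < |∑ k ∈ Finset.range n, w k * clip M (X k ω)|} ≤
      n * (∫ ω, clip M (θ ω) ^ 2 ∂P) / (t / 2) ^ 2 := by
  set Z : ℕ → Ω → ℝ := fun k ω => w k * clip M (X k ω) with hZ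
  have hZmem : ∀ k, MemLp (Z k) 2 P := fun k => by
    refine MemLp.of_bound (C := M)
      (((measurable_clip M).comp_aemeasurable (hcopy k).aemeasurable_fst).const_mul
        (w k)).aestronglyMeasurable (Filter.Eventually.of_forall fun ω => ?_)
    rw [Real.norm_eq_abs, abs_mul]
    exact (mul_le_of_le_one_left (abs_nonneg _) (hw k)).trans (abs_clip_le hM _)
  have hZind : iIndepFun Z P := iIndepFun_mul_clip hindep w M
  have hvar : variance (∑ k ∈ Finset.range n, Z k) P ≤ n * ∫ ω, clip M (θ ω) ^ 2 ∂P := by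
    rw [IndepFun.variance_sum (fun k _ => hZmem k) fun i _ j _ hij => hZind.indepFun hij]
    have : ∀ k ∈ Finset.range n, variance (Z k) P ≤ ∫ ω, clip M (θ ω) ^ 2 ∂P := fun k _ => by
      refine (variance_le_expectation_sq (hZmem k).aestronglyMeasurable).trans ?_
      rw [← integral_comp_clip_eq hcopy M (g := fun x => x ^ 2)
        (measurable_id.pow_const 2) k]
      refine integral_mono (hZmem k).integrable_sq
        (integrable_comp_clip (hcopy k).aemeasurable_fst hM (continuous_pow 2)) fun ω => ?_
      simp only [hZ, Pi.pow_apply, mul_pow]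
      refine mul_le_of_le_one_left (sq_nonneg _) ?_
      rw [← sq_abs]
      exact pow_le_one₀ (abs_nonneg _) (hw k)
    refine (Finset.sum_le_sum this).trans (le_of_eq ?_)
    simp
  have hcheb := meas_ge_le_variance_div_sq (memLp_finsetSum' (Finset.range n) fun k _ => hZmem k)
    (half_pos ht)
  have hcheb' : P.real {ω | t / 2 ≤ |(∑ k ∈ Finset.range n, Z k) ω -
      ∫ ω, (∑ k ∈ Finset.range n, Z k) ω ∂P|} ≤
      variance (∑ k ∈ Finset.range n, Z k) P / (t / 2) ^ 2 := by
    refine ENNReal.toReal_le_of_le_ofReal ?_ hcheb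
    exact div_nonneg (variance_nonneg _ _) (sq_nonneg _)
  calc _ ≤ _ := measureReal_mono fun ω hω => ?_
    _ ≤ _ := hcheb'
    _ ≤ _ := by gcongr
  have hω' : t < |∑ k ∈ Finset.range n, Z k ω| := hω
  have hm := (abs_integral_sum_clip_le hcopy hw n hM).trans hmean
  simp only [Finset.sum_apply, Set.mem_ofPred_eq]
  have := abs_sub_abs_le_abs_sub (∑ k ∈ Finset.range n, Z k ω)
    (∫ ω, ∑ k ∈ Finset.range n, Z k ω ∂P)
  linarith

/-- A second order expansion of the exponential, integrated and closed with `1 + x ≤ exp x`. The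
linear term survives because the truncated variable need not be centred. -/
theorem mgf_mul_clip_le (hθ : AEMeasurable θ P) {c M l m s : ℝ} (hc : |c| ≤ 1) (hM : 0 ≤ M)
    (hl : 0 ≤ l) (hm : |∫ ω, clip M (θ ω) ∂P| ≤ m) (hs : ∫ ω, clip M (θ ω) ^ 2 ∂P ≤ s) :
    mgf (fun ω => c * clip M (θ ω)) P l ≤
      Real.exp (l * m + l ^ 2 * s * Real.exp (l * M)) := by
  have hclip : Integrable (fun ω => clip M (θ ω)) P := integrable_comp_clip hθ hM continuous_id
  have hsq : Integrable (fun ω => clip M (θ ω) ^ 2) P :=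
    integrable_comp_clip hθ hM (continuous_pow 2)
  have hexp : Integrable (fun ω => Real.exp (l * (c * clip M (θ ω)))) P :=
    integrable_comp_clip hθ hM (g := fun x => Real.exp (l * (c * x))) (by fun_prop)
  have hpt : ∀ ω, Real.exp (l * (c * clip M (θ ω))) ≤
      1 + l * c * clip M (θ ω) + l ^ 2 * Real.exp (l * M) * clip M (θ ω) ^ 2 := by
    intro ω
    refine (exp_le_one_add_self_add_sq_mul _).trans ?_
    have h1 : |c * clip M (θ ω)| ≤ M := by
      rw [abs_mul]
      exact (mul_le_of_le_one_left (abs_nonneg _) hc).trans (abs_clip_le hM _)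
    have h2 : |l * (c * clip M (θ ω))| ≤ l * M := by
      rw [abs_mul, abs_of_nonneg hl]
      gcongr
    have h3 : c ^ 2 ≤ 1 := by
      rw [← sq_abs]
      exact pow_le_one₀ (abs_nonneg _) hc
    have h4 : (l * (c * clip M (θ ω))) ^ 2 ≤ l ^ 2 * clip M (θ ω) ^ 2 := by
      rw [mul_pow, mul_pow]
      gcongr
      exact mul_le_of_le_one_left (sq_nonneg _) h3
    have h5 : (l * (c * clip M (θ ω))) ^ 2 * Real.exp |l * (c * clip M (θ ω))| ≤
        l ^ 2 * clip M (θ ω) ^ 2 * Real.exp (l * M) := by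
      gcongr
    linarith
  have hi1 : Integrable (fun ω => 1 + l * c * clip M (θ ω)) P :=
    (integrable_const 1).add (hclip.const_mul _)
  calc mgf (fun ω => c * clip M (θ ω)) P l
      ≤ ∫ ω, (1 + l * c * clip M (θ ω) + l ^ 2 * Real.exp (l * M) * clip M (θ ω) ^ 2) ∂P :=
        integral_mono hexp (hi1.add (hsq.const_mul _)) hpt
    _ = 1 + l * c * (∫ ω, clip M (θ ω) ∂P) +
          l ^ 2 * Real.exp (l * M) * ∫ ω, clip M (θ ω) ^ 2 ∂P := by
        rw [integral_add hi1 (hsq.const_mul _), integral_add (integrable_const 1)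
          (hclip.const_mul _), integral_const_mul, integral_const_mul]
        simp
    _ ≤ 1 + l * m + l ^ 2 * Real.exp (l * M) * s := by
        have : c * ∫ ω, clip M (θ ω) ∂P ≤ m := by
          refine (le_abs_self _).trans ?_
          rw [abs_mul]
          exact (mul_le_of_le_one_left (abs_nonneg _) hc).trans hm
        rw [mul_assoc l c]
        gcongr
    _ ≤ _ := by
        have := Real.add_one_le_exp (l * m + l ^ 2 * s * Real.exp (l * M))
        linarith

theorem prob_le_sum_clip_le_exp (hindep : iIndepFun X P)
    (hcopy : ∀ k, IdentDistrib (X k) θ P P) {w : ℕ → ℝ}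
    (hw : ∀ k, |w k| ≤ 1) (n : ℕ) {M l m s : ℝ} (hM : 0 ≤ M) (hl : 0 ≤ l)
    (hm : |∫ ω, clip M (θ ω) ∂P| ≤ m) (hs : ∫ ω, clip M (θ ω) ^ 2 ∂P ≤ s) (t : ℝ) :
    P.real {ω | t ≤ ∑ k ∈ Finset.range n, w k * clip M (X k ω)} ≤
      Real.exp (-l * t + n * (l * m + l ^ 2 * s * Real.exp (l * M))) := by
  set Z : ℕ → Ω → ℝ := fun k ω => w k * clip M (X k ω) with hZ
  have hZind : iIndepFun Z P := iIndepFun_mul_clip hindep w M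
  have hZmeas : ∀ k, AEMeasurable (Z k) P := fun k =>
    ((measurable_clip M).comp_aemeasurable (hcopy k).aemeasurable_fst).const_mul (w k)
  have hZbound : ∀ k ω, |Z k ω| ≤ M := fun k ω => by
    rw [abs_mul]
    exact (mul_le_of_le_one_left (abs_nonneg _) (hw k)).trans (abs_clip_le hM _)
  have hint : Integrable (fun ω => Real.exp (l * (∑ k ∈ Finset.range n, Z k) ω)) P := by
    refine Integrable.of_bound (C := Real.exp (l * (n * M)))
      (Real.measurable_exp.comp_aemeasurable
        ((Finset.aemeasurable_sum _ fun k _ => hZmeas k).const_mul l)).aestronglyMeasurable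
      (Filter.Eventually.of_forall fun ω => ?_)
    rw [Real.norm_eq_abs, Real.abs_exp, Real.exp_le_exp]
    refine mul_le_mul_of_nonneg_left ?_ hl
    rw [Finset.sum_apply]
    refine (Finset.sum_le_sum fun k _ => (le_abs_self _).trans (hZbound k ω)).trans ?_
    simp
  have hchernoff := measure_ge_le_exp_mul_mgf (μ := P) (X := ∑ k ∈ Finset.range n, Z k) t hl hint
  simp only [Finset.sum_apply] at hchernoff
  refine hchernoff.trans ?_
  rw [Real.exp_add, hZind.mgf_sum₀ hZmeas]
  refine mul_le_mul_of_nonneg_left ?_ (Real.exp_pos _).le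
  rw [Real.exp_nat_mul]
  refine (Finset.prod_le_prod (fun k _ => mgf_nonneg) fun k _ =>
    mgf_mul_clip_le (hcopy k).aemeasurable_fst (hw k) hM hl (m := m) (s := s) ?_ ?_).trans ?_
  · rwa [integral_comp_clip_eq hcopy M (g := fun x => x) measurable_id]
  · rwa [integral_comp_clip_eq hcopy M (g := fun x => x ^ 2) (measurable_id.pow_const 2)]
  · simp

theorem prob_lt_abs_sum_clip_le_exp (hindep : iIndepFun X P)
    (hcopy : ∀ k, IdentDistrib (X k) θ P P) {w : ℕ → ℝ}
    (hw : ∀ k, |w k| ≤ 1) (n : ℕ) {M l m s : ℝ} (hM : 0 ≤ M) (hl : 0 ≤ l)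
    (hm : |∫ ω, clip M (θ ω) ∂P| ≤ m) (hs : ∫ ω, clip M (θ ω) ^ 2 ∂P ≤ s) (t : ℝ) :
    P.real {ω | t < |∑ k ∈ Finset.range n, w k * clip M (X k ω)|} ≤
      2 * Real.exp (-l * t + n * (l * m + l ^ 2 * s * Real.exp (l * M))) := by
  have hpos := prob_le_sum_clip_le_exp hindep hcopy hw n hM hl hm hs t
  have hneg := prob_le_sum_clip_le_exp hindep hcopy (w := fun k => -w k)
    (fun k => by rw [abs_neg]; exact hw k) n hM hl hm hs t
  rw [two_mul]
  refine le_trans (measureReal_mono fun ω hω => ?_)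
    ((measureReal_union_le _ _).trans (add_le_add hpos hneg))
  have hω' : t < |∑ k ∈ Finset.range n, w k * clip M (X k ω)| := hω
  simp only [Set.mem_union, Set.mem_ofPred_eq, neg_mul, Finset.sum_neg_distrib]
  rcases lt_abs.1 hω' with h | h
  · exact Or.inl h.le
  · exact Or.inr h.le

end WeightedSums

/-! ### Complete convergence in the three ranges of `r`. -/

/-- The exponents arising in the exponential bound at truncation level `δ n ^ (1 / p)` are
negligible. -/
theorem tendsto_log_mul_rpow_add_log_sq_mul_rpow {x y : ℝ} (hx : x < 0) (hy : y < 0)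
    (c d : ℝ) :
    Filter.Tendsto (fun n : ℕ => c * (Real.log n * (n : ℝ) ^ x) +
      d * (Real.log n ^ 2 * (n : ℝ) ^ y)) Filter.atTop (nhds 0) := by
  have hlog : ∀ (k : ℕ) {z : ℝ}, z < 0 → Filter.Tendsto
      (fun n : ℕ => Real.log n ^ k * (n : ℝ) ^ z) Filter.atTop (nhds 0) := by
    intro k z hz
    have h := (isLittleO_log_rpow_rpow_atTop (k : ℝ) (neg_pos.2 hz)).tendsto_div_nhds_zero
    refine (h.comp tendsto_natCast_atTop_atTop).congr fun n => ?_
    simp only [Function.comp_apply, Real.rpow_natCast]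
    rw [Real.rpow_neg (Nat.cast_nonneg n), div_inv_eq_mul]
  have h := ((hlog 1 hx).const_mul c).add ((hlog 2 hy).const_mul d)
  simpa using h

section CompleteConvergence

variable {Ω : Type*} [MeasurableSpace Ω] {P : Measure Ω} [IsProbabilityMeasure P] {θ : Ω → ℝ}
  {X : ℕ → Ω → ℝ} {p r ε : ℝ} {w : ℕ → ℕ → ℝ}

theorem summable_prob_sum_clip_of_lt_one (hcopy : ∀ k, IdentDistrib (X k) θ P P)
    (hw : ∀ n k, |w n k| ≤ 1) (hp₀ : 0 < p) (hr₁ : r < 1)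
    (hmoment : Integrable (fun ω => |θ ω| ^ r) P) (hε : 0 < ε) :
    Summable fun n : ℕ => (n : ℝ) ^ (r / p - 2) * P.real {ω | ε * (n : ℝ) ^ (1 / p) <
      |∑ k ∈ Finset.range n, w n k * clip ((n : ℝ) ^ (1 / p)) (X k ω)|} := by
  have hθ : AEMeasurable θ P := (hcopy 0).aemeasurable_snd
  have hS := (summable_integral_abs_clip_rpow hθ hp₀ one_pos hr₁ hmoment).mul_left ε⁻¹
  refine hS.of_norm_bounded_eventually_nat ?_
  filter_upwards [Filter.eventually_gt_atTop 0] with n hn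
  have hn0 : (0 : ℝ) < n := by exact_mod_cast hn
  rw [Real.norm_eq_abs, abs_of_nonneg (by positivity)]
  refine (mul_le_mul_of_nonneg_left (prob_lt_abs_sum_clip_le_integral_abs hcopy (hw n) n
    (by positivity) (by positivity)) (by positivity)).trans (le_of_eq ?_)
  simp only [Real.rpow_one]
  have h : (n : ℝ) ^ ((r - 1) / p - 1) = (n : ℝ) ^ (r / p - 2) * n / (n : ℝ) ^ (1 / p) := by
    rw [← Real.rpow_add_one hn0.ne', ← Real.rpow_sub hn0]
    congr 1
    ring
  rw [h]
  field_simp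

/-- The powers of `n` combine to `n ^ (1 - r / p) ≤ 1`. At `r = p` they give no decay, so the limit
comes from the vanishing tail of the `r`-th moment. -/
theorem tendsto_mul_abs_integral_clip (hθ : AEMeasurable θ P) (hp₀ : 0 < p) (hr : p ≤ r)
    (hr₁ : 1 ≤ r) (hmoment : Integrable (fun ω => |θ ω| ^ r) P) (hmean : ∫ ω, θ ω ∂P = 0) :
    Filter.Tendsto (fun n : ℕ => n * |∫ ω, clip ((n : ℝ) ^ (1 / p)) (θ ω) ∂P| /
      (n : ℝ) ^ (1 / p)) Filter.atTop (nhds 0) := by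
  have hM : Filter.Tendsto (fun n : ℕ => (n : ℝ) ^ (1 / p)) Filter.atTop Filter.atTop :=
    (tendsto_rpow_atTop (by positivity)).comp tendsto_natCast_atTop_atTop
  refine squeeze_zero' (Filter.Eventually.of_forall fun n => by positivity) ?_
    (tendsto_integral_indicator_abs_rpow hθ hmoment hM)
  filter_upwards [Filter.eventually_gt_atTop 0] with n hn
  have hn0 : (0 : ℝ) < n := by exact_mod_cast hn
  have hn1 : (1 : ℝ) ≤ n := by exact_mod_cast hn
  set I := ∫ ω, Set.indicator {y : ℝ | (n : ℝ) ^ (1 / p) < |y|} (fun y => |y| ^ r) (θ ω) ∂P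
    with hI
  have hI0 : 0 ≤ I := integral_nonneg fun ω => Set.indicator_nonneg (fun _ _ => by positivity) _
  have h := abs_integral_clip_le hθ hr₁ (by positivity : 0 < (n : ℝ) ^ (1 / p)) hmoment hmean
  rw [← Real.rpow_mul hn0.le] at h
  calc n * |∫ ω, clip ((n : ℝ) ^ (1 / p)) (θ ω) ∂P| / (n : ℝ) ^ (1 / p)
      ≤ n * ((n : ℝ) ^ (1 / p * (1 - r)) * I) / (n : ℝ) ^ (1 / p) := by gcongr
    _ = (n : ℝ) ^ (1 - r / p) * I := by
        have : (n : ℝ) ^ (1 - r / p) = n ^ (1 / p * (1 - r)) * n / (n : ℝ) ^ (1 / p) := by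
          rw [← Real.rpow_add_one hn0.ne', ← Real.rpow_sub hn0]
          congr 1
          ring
        rw [this]
        ring
    _ ≤ I := by
        refine mul_le_of_le_one_left hI0 (Real.rpow_le_one_of_one_le_of_nonpos hn1 ?_)
        rw [sub_nonpos, one_le_div hp₀]
        exact hr

theorem summable_prob_sum_clip_of_lt_two (hindep : iIndepFun X P)
    (hcopy : ∀ k, IdentDistrib (X k) θ P P)
    (hw : ∀ n k, |w n k| ≤ 1) (hp₀ : 0 < p) (hr : p ≤ r) (hr₁ : 1 ≤ r) (hr₂ : r < 2)
    (hmoment : Integrable (fun ω => |θ ω| ^ r) P) (hmean : ∫ ω, θ ω ∂P = 0) (hε : 0 < ε) :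
    Summable fun n : ℕ => (n : ℝ) ^ (r / p - 2) * P.real {ω | ε * (n : ℝ) ^ (1 / p) <
      |∑ k ∈ Finset.range n, w n k * clip ((n : ℝ) ^ (1 / p)) (X k ω)|} := by
  have hθ : AEMeasurable θ P := (hcopy 0).aemeasurable_snd
  have hS := (summable_integral_abs_clip_rpow hθ hp₀ two_pos hr₂ hmoment).mul_left
    ((ε / 2) ^ 2)⁻¹
  refine hS.of_norm_bounded_eventually_nat ?_
  filter_upwards [Filter.eventually_gt_atTop 0,
    (tendsto_mul_abs_integral_clip hθ hp₀ hr hr₁ hmoment hmean).eventually_le_const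
      (half_pos hε)] with n hn hcentre
  have hn0 : (0 : ℝ) < n := by exact_mod_cast hn
  have hn' : 0 < (n : ℝ) ^ (1 / p) := by positivity
  rw [div_le_iff₀ hn'] at hcentre
  rw [Real.norm_eq_abs, abs_of_nonneg (by positivity)]
  refine (mul_le_mul_of_nonneg_left (prob_lt_abs_sum_clip_le_integral_sq hindep hcopy (hw n) n
    (by positivity) (by positivity) (by linarith)) (by positivity)).trans (le_of_eq ?_)
  simp only [Real.rpow_two, sq_abs]
  have h : (n : ℝ) ^ ((r - 2) / p - 1) =
      (n : ℝ) ^ (r / p - 2) * n / ((n : ℝ) ^ (1 / p)) ^ 2 := by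
    rw [← Real.rpow_add_one hn0.ne', ← Real.rpow_natCast, ← Real.rpow_mul hn0.le,
      ← Real.rpow_sub hn0]
    congr 1
    push_cast
    ring
  rw [h]
  field_simp

theorem integrable_sq_of_integrable_abs_rpow (hθ : AEMeasurable θ P) (hr₂ : 2 ≤ r)
    (hmoment : Integrable (fun ω => |θ ω| ^ r) P) : Integrable (fun ω => θ ω ^ 2) P := by
  refine integrable_of_integrable_abs_rpow (hθ.pow_const 2) (r := r / 2) (by linarith) ?_
  refine hmoment.congr (Filter.Eventually.of_forall fun ω => ?_)
  simp only
  rw [abs_pow, ← Real.rpow_natCast, ← Real.rpow_mul (abs_nonneg _)]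
  congr 1
  push_cast
  ring

theorem summable_prob_sum_clip_of_two_le (hindep : iIndepFun X P)
    (hcopy : ∀ k, IdentDistrib (X k) θ P P)
    (hw : ∀ n k, |w n k| ≤ 1) (hp₀ : 0 < p) (hp₂ : p < 2) (hr₂ : 2 ≤ r)
    (hmoment : Integrable (fun ω => |θ ω| ^ r) P) (hmean : ∫ ω, θ ω ∂P = 0) (hε : 0 < ε) :
    ∃ δ > 0, Summable fun n : ℕ => (n : ℝ) ^ (r / p - 2) * P.real {ω | ε * (n : ℝ) ^ (1 / p) <
      |∑ k ∈ Finset.range n, w n k * clip (δ * (n : ℝ) ^ (1 / p)) (X k ω)|} := by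
  have hθ : AEMeasurable θ P := (hcopy 0).aemeasurable_snd
  have hr₀ : 0 < r := by linarith
  have hgap : 0 < 2 / p - 1 := by
    rw [sub_pos, one_lt_div hp₀]
    exact hp₂
  -- With `l = κ log n / n ^ (1 / p)`, this `κ` makes the main Chernoff factor exactly `n ^ (-r /
  -- p)`.
  set κ := r / p / ε with hκ
  have hκ0 : 0 < κ := by positivity
  -- Then `exp (l M)` is `n` to half the gap `2 / p - 1`, while `n l ^ 2` decays like `log² n` times
  -- `n` to minus the full gap. This is where `p < 2` enters.
  set δ := (2 / p - 1) / 2 / κ with hδ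
  have hδ0 : 0 < δ := by positivity
  have hκδ : κ * δ = (2 / p - 1) / 2 := by
    rw [hδ]
    field_simp
  set A := ∫ ω, |θ ω| ^ r ∂P with hA
  set B := ∫ ω, θ ω ^ 2 ∂P with hB
  have hneg := tendsto_log_mul_rpow_add_log_sq_mul_rpow (x := 1 - r / p)
    (y := -((2 / p - 1) / 2)) (by rw [sub_neg, one_lt_div hp₀]; linarith) (by linarith)
    (κ * δ ^ (1 - r) * A) (κ ^ 2 * B)
  refine ⟨δ, hδ0, ?_⟩
  -- The error exponents are eventually at most 1, whence the factor `exp 1`; the weight `n ^ (r / p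
  -- - 2)` times `n ^ (-r / p)` leaves `n ^ (-2)`.
  refine ((Real.summable_nat_rpow.2 (by norm_num : (-2 : ℝ) < -1)).mul_left
    (2 * Real.exp 1)).of_norm_bounded_eventually_nat ?_
  filter_upwards [Filter.eventually_gt_atTop 0, hneg.eventually_le_const one_pos] with n hn hsmall
  have hn0 : (0 : ℝ) < n := by exact_mod_cast hn
  have hn1 : (1 : ℝ) ≤ n := by exact_mod_cast hn
  have hlog : 0 ≤ Real.log n := Real.log_nonneg hn1
  have hn' : 0 < (n : ℝ) ^ (1 / p) := by positivity
  set M := δ * (n : ℝ) ^ (1 / p) with hM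
  have hM0 : 0 < M := by positivity
  set l := κ * Real.log n / (n : ℝ) ^ (1 / p) with hl
  have hl0 : 0 ≤ l := by positivity
  have hm : |∫ ω, clip M (θ ω) ∂P| ≤ M ^ (1 - r) * A := by
    refine (abs_integral_clip_le hθ (by linarith) hM0 hmoment hmean).trans ?_
    refine mul_le_mul_of_nonneg_left (integral_mono ?_ hmoment fun ω => ?_) (by positivity)
    · exact hmoment.indicator₀
        (nullMeasurableSet_lt aemeasurable_const hθ.abs : NullMeasurableSet {ω | M < |θ ω|} P)
    · exact Set.indicator_le_self' (fun _ _ => by positivity) _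
  have hs : ∫ ω, clip M (θ ω) ^ 2 ∂P ≤ B :=
    integral_mono (integrable_comp_clip hθ hM0.le (continuous_pow 2))
      (integrable_sq_of_integrable_abs_rpow hθ hr₂ hmoment)
      fun ω => sq_le_sq.2 (abs_clip_le_abs _ _)
  have hbound := prob_lt_abs_sum_clip_le_exp hindep hcopy (hw n) n hM0.le hl0 hm hs
    (ε * (n : ℝ) ^ (1 / p))
  have hlt : l * (ε * (n : ℝ) ^ (1 / p)) = Real.log n * (r / p) := by
    rw [hl, hκ]
    field_simp
  have hexpM : Real.exp (l * M) = (n : ℝ) ^ ((2 / p - 1) / 2) := by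
    rw [Real.rpow_def_of_pos hn0, ← hκδ, hl, hM]
    congr 1
    field_simp
  have hfirst : n * (l * (M ^ (1 - r) * A)) =
      κ * δ ^ (1 - r) * A * (Real.log n * (n : ℝ) ^ (1 - r / p)) := by
    have h : (n : ℝ) ^ (1 - r / p) = ((n : ℝ) ^ (1 / p)) ^ (1 - r) * n / (n : ℝ) ^ (1 / p) := by
      rw [← Real.rpow_mul hn0.le, ← Real.rpow_add_one hn0.ne', ← Real.rpow_sub hn0]
      congr 1
      ring
    rw [h, hl, hM, Real.mul_rpow hδ0.le hn'.le]
    ring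
  have hsecond : n * (l ^ 2 * B * Real.exp (l * M)) =
      κ ^ 2 * B * (Real.log n ^ 2 * (n : ℝ) ^ (-((2 / p - 1) / 2))) := by
    have h : (n : ℝ) ^ (-((2 / p - 1) / 2)) =
        (n : ℝ) ^ ((2 / p - 1) / 2) * n / ((n : ℝ) ^ (1 / p)) ^ 2 := by
      rw [← Real.rpow_add_one hn0.ne', ← Real.rpow_natCast, ← Real.rpow_mul hn0.le,
        ← Real.rpow_sub hn0]
      congr 1
      push_cast
      ring
    rw [hexpM, h, hl, div_pow]
    ring
  rw [Real.norm_eq_abs, abs_of_nonneg (by positivity)]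
  have hexponent : -l * (ε * (n : ℝ) ^ (1 / p)) +
      n * (l * (M ^ (1 - r) * A) + l ^ 2 * B * Real.exp (l * M)) ≤
        1 + Real.log n * (-(r / p)) := by
    rw [mul_add, hfirst, hsecond, neg_mul, hlt]
    linarith
  calc _ ≤ (n : ℝ) ^ (r / p - 2) * (2 * Real.exp (1 + Real.log n * (-(r / p)))) := by
        gcongr
        exact hbound.trans (by gcongr)
    _ = 2 * Real.exp 1 * (n : ℝ) ^ (-2 : ℝ) := by
        rw [Real.exp_add, ← Real.rpow_def_of_pos hn0,
          show (-2 : ℝ) = r / p - 2 + -(r / p) by ring, Real.rpow_add hn0 (r / p - 2)]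
        ring

/-- Complete convergence of sums of independent copies with weights bounded by one. -/
theorem summable_prob_weighted_sum_of_abs_le_one (hindep : iIndepFun X P)
    (hcopy : ∀ k, IdentDistrib (X k) θ P P)
    (hw : ∀ n k, |w n k| ≤ 1) (hp₀ : 0 < p) (hp₂ : p < 2) (hr : p ≤ r)
    (hmoment : Integrable (fun ω => |θ ω| ^ r) P) (hmean : 1 ≤ r → ∫ ω, θ ω ∂P = 0)
    (hε : 0 < ε) :
    Summable fun n : ℕ => (n : ℝ) ^ (r / p - 2) * P.real {ω | ε * (n : ℝ) ^ (1 / p) <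
      |∑ k ∈ Finset.range n, w n k * X k ω|} := by
  -- The level is existential because for `r ≥ 2` it depends on `ε`; otherwise `δ = 1` serves.
  obtain ⟨δ, hδ, hS⟩ : ∃ δ > 0, Summable fun n : ℕ => (n : ℝ) ^ (r / p - 2) *
      P.real {ω | ε * (n : ℝ) ^ (1 / p) <
        |∑ k ∈ Finset.range n, w n k * clip (δ * (n : ℝ) ^ (1 / p)) (X k ω)|} := by
    rcases lt_or_ge r 1 with h1 | h1
    · refine ⟨1, one_pos, ?_⟩
      simpa only [one_mul] using
        summable_prob_sum_clip_of_lt_one hcopy hw hp₀ h1 hmoment hε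
    rcases lt_or_ge r 2 with h2 | h2
    · refine ⟨1, one_pos, ?_⟩
      simpa only [one_mul] using
        summable_prob_sum_clip_of_lt_two hindep hcopy hw hp₀ hr h1 h2 hmoment (hmean h1) hε
    · exact summable_prob_sum_clip_of_two_le hindep hcopy hw hp₀ hp₂ h2 hmoment (hmean h1) hε
  have hθ : AEMeasurable θ P := (hcopy 0).aemeasurable_snd
  refine ((summable_rpow_mul_prob_lt_abs hθ hp₀ hr hδ hmoment).add
    hS).of_norm_bounded_eventually_nat ?_
  filter_upwards [Filter.eventually_gt_atTop 0] with n hn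
  have hn0 : (0 : ℝ) < n := by exact_mod_cast hn
  rw [Real.norm_eq_abs, abs_of_nonneg (by positivity)]
  refine (mul_le_mul_of_nonneg_left (prob_lt_abs_sum_le_add hcopy (w n) n
    (δ * (n : ℝ) ^ (1 / p)) _) (by positivity)).trans (le_of_eq ?_)
  rw [mul_add, ← mul_assoc, ← Real.rpow_add_one hn0.ne']
  congr 3
  ring

/-- Complete convergence of sums of independent copies with bounded weights. -/
theorem summable_prob_weighted_sum {C : ℝ} (hindep : iIndepFun X P)
    (hcopy : ∀ k, IdentDistrib (X k) θ P P) (hC : 0 < C)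
    (hw : ∀ n k, |w n k| ≤ C) (hp₀ : 0 < p) (hp₂ : p < 2) (hr : p ≤ r)
    (hmoment : Integrable (fun ω => |θ ω| ^ r) P) (hmean : 1 ≤ r → ∫ ω, θ ω ∂P = 0)
    (hε : 0 < ε) :
    Summable fun n : ℕ => (n : ℝ) ^ (r / p - 2) * P.real {ω | ε * (n : ℝ) ^ (1 / p) <
      |∑ k ∈ Finset.range n, w n k * X k ω|} := by
  have h := summable_prob_weighted_sum_of_abs_le_one (w := fun n k => w n k / C) hindep hcopy
    (fun n k => by rw [abs_div, abs_of_pos hC, div_le_one hC]; exact hw n k) hp₀ hp₂ hr hmoment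
    hmean (div_pos hε hC)
  refine h.congr fun n => ?_
  congr 3
  ext ω
  simp only [div_mul_eq_mul_div, ← Finset.sum_div]
  rw [abs_div, abs_of_pos hC, div_lt_div_iff_of_pos_right hC]

end CompleteConvergence

/-! ### Return to the autoregressive sequence. -/

theorem theorem1 {Ω : Type*} [MeasurableSpace Ω] (P : Measure Ω) [IsProbabilityMeasure P]
    (a b p r : ℝ) (θ : Ω → ℝ) (θs : ℕ+ → Ω → ℝ) (ξ : ℤ → Ω → ℝ)
    (hindep : iIndepFun θs P) (hcopy : ∀ k, IdentDistrib (θs k) θ P P)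
    (hξ : IsAutoregressive2 a b θs ξ)
    (hb₁ : -1 < b) (hb₂ : b < 1 - |a|)
    (hp₀ : 0 < p) (hp₂ : p < 2) (hr : p ≤ r)
    (hmoment : Integrable (fun ω => |θ ω| ^ r) P)
    (hmean : 1 ≤ r → ∫ ω, θ ω ∂P = 0)
    (ε : ℝ) (hε : 0 < ε) :
    Summable (fun n : ℕ+ => ((n : ℕ) : ℝ) ^ (r / p - 2) *
      P.real {ω | |partialSum ξ n ω| / ((n : ℕ) : ℝ) ^ (1 / p) > ε}) := by
  obtain ⟨C, hC, hbound⟩ := exists_bound_stepResponse hb₁ hb₂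
  -- For `k ≥ n` the truncated subtraction gives the weight `stepResponse a b 0`; such terms lie
  -- outside the sum but still obey the bound required for all `k`.
  have h := summable_prob_weighted_sum (w := fun n k => stepResponse a b (n - 1 - k))
    (X := fun k => θs k.succPNat) (hindep.precomp Nat.succPNat_injective)
    (fun k => hcopy k.succPNat) hC (fun n k => hbound _) hp₀ hp₂ hr hmoment hmean hε
  refine (h.comp_injective PNat.coe_injective).congr fun n => ?_
  have hn : (0 : ℝ) < ((n : ℕ) : ℝ) ^ (1 / p) := by
    have : (0 : ℝ) < ((n : ℕ) : ℝ) := by exact_mod_cast n.pos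
    positivity
  simp only [Function.comp_apply, gt_iff_lt, lt_div_iff₀ hn, partialSum_eq_sum_stepResponse hξ]
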